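/- Let $n\in\mathbb N$, $0<\epsilon\le 1$, $\epsilon<R$ and $r\ge 0$. Let $L_{n,\epsilon}=\{(i\epsilon,j\epsilon): i,j\in\mathbb N,\ i,j\le \sqrt n/\epsilon\}$, let $d$ be the Euclidean distance, and for $x\in L_{n,\epsilon}$ put $\Gamma(x)=\{y\in L_{n,\epsilon}: d(x,y)\le r\}$. The stationary geometric-MEG $\mathcal G(n,r,R,\epsilon)=\{G_t: t\in\mathbb N\}$ is the random sequence of graphs on the node set $[n]$ defined as follows: the nodes perform independent Markov chains $(P_{i,t})_{t\in\mathbb N}$, $i\in[n]$, on $L_{n,\epsilon}$, where $P_{i,t+1}$ is uniform on $\Gamma(P_{i,t})$ and $P_{i,0}$ has the stationary distribution $\pi(x)=|\Gamma(x)|/\sum_{y\in L_{n,\epsilon}}|\Gamma(y)|$; distinct nodes $i,j$ are adjacent in $G_t$ if and only if $d(P_{i,t},P_{j,t})\le R$. For a source $s\in[n]$ let $I_0=\{s\}$ and let $I_{t+1}$ consist of $I_t$ and all nodes adjacent in $G_t$ to a node of $I_t$; let $T(s)=\min\{t: I_t=[n]\}$ ($\infty$ if there is no such $t$). The flooding time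 is $\max_{s\in[n]}T(s)$. **Corollary.** There is a constant $c>0$ such that for every $K>0$ there are constants $a,b>0$ and $n_0$, depending only on $K$, with the following property. For all $n\ge n_0$ and all $r,R,\epsilon$ with $0<\epsilon\le1$, $\epsilon<R$, $0\le r\le KR$ and $$c\sqrt{\log n}\le R\le \frac{\sqrt n}{\log\log n},$$ with probability at least $1-1/n$ the flooding time $T$ of the stationary geometric-MEG $\mathcal G(n,r,R,\epsilon)$ is finite and satisfies $$a\,\frac{\sqrt n}{R}\le T\le b\,\frac{\sqrt n}{R}.$$ -/

import Mathlib

open MeasureTheory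

noncomputable section

/-! ### Flooding in an evolving graph -/

/-- The out-neighbourhood `N(I)`: nodes outside `I` that are adjacent to some node of `I`. -/
def outNeighbors {V : Type*} (G : SimpleGraph V) (I : Set V) : Set V :=
  {v | v ∉ I ∧ ∃ u ∈ I, G.Adj u v}

/-- The set `I_t` of informed nodes at time `t`, for the flooding process with source `s`:
`I_0 = {s}` and `I_{t+1} = I_t ∪ N(I_t)`, where `N` is taken in the graph at time `t`. -/
def informed {V : Type*} (G : ℕ → SimpleGraph V) (s : V) : ℕ → Set V
  | 0 => {s}
  | t + 1 => informed G s t ∪ outNeighbors (G t) (informed G s t)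

/-- The first time step at which all nodes are informed (`⊤` if there is none). -/
def completionTime {V : Type*} (G : ℕ → SimpleGraph V) (s : V) : ℕ∞ :=
  ⨅ (t : ℕ) (_ : informed G s t = Set.univ), (t : ℕ∞)

/-- The flooding time: the maximum completion time over all sources. -/
def floodingTime {V : Type*} (G : ℕ → SimpleGraph V) : ℕ∞ :=
  ⨆ s : V, completionTime G s

/-! ### Markov chains -/

/-- `p` is a stationary probability distribution of the transition matrix `K`. -/
structure IsStationaryDistribution {S : Type*} [Fintype S] (K : S → S → ℝ) (p : S → ℝ) :
    Prop where
  nonneg : ∀ x, 0 ≤ p x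
  sum_eq_one : ∑ x, p x = 1
  invariant : ∀ y, ∑ x, p x * K x y = p y

/-- `X` is a Markov chain with initial distribution `p` and transition matrix `K`: given the
whole history up to time `t`, the state at time `t + 1` is `y` with probability `K (X t) y`. -/
structure IsMarkovChain {Ω S : Type*} [MeasurableSpace Ω] [MeasurableSpace S]
    (μ : Measure Ω) (p : S → ℝ) (K : S → S → ℝ) (X : ℕ → Ω → S) : Prop where
  measurable : ∀ t, Measurable (X t)
  initial : ∀ x, μ.real {ω | X 0 ω = x} = p x
  step : ∀ (t : ℕ) (x : ℕ → S), μ.real {ω | ∀ s ≤ t + 1, X s ω = x s} =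
    μ.real {ω | ∀ s ≤ t, X s ω = x s} * K (x t) (x (t + 1))

/-! ### The geometric Markovian evolving graph -/

/-- Indices of the grid `L_{n,ε}`: pairs `(i, j)` of natural numbers at most `√n / ε`. -/
abbrev Site (n : ℕ) (ε : ℝ) : Type :=
  Fin (⌊√(n : ℝ) / ε⌋₊ + 1) × Fin (⌊√(n : ℝ) / ε⌋₊ + 1)

/-- The point `(i ε, j ε)` of the Euclidean plane with index `(i, j)`. -/
def Site.point {n : ℕ} {ε : ℝ} (x : Site n ε) : EuclideanSpace ℝ (Fin 2) :=
  !₂[((x.1 : ℕ) : ℝ) * ε, ((x.2 : ℕ) : ℝ) * ε]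

open Classical in
/-- `Γ(x)`: the grid points within Euclidean distance `r` from `x` (including `x`). -/
def reach {n : ℕ} {ε : ℝ} (r : ℝ) (x : Site n ε) : Finset (Site n ε) :=
  {y | dist x.point y.point ≤ r}

open Classical in
/-- One step of a node: from `x` to a uniformly chosen point of `Γ(x)`. -/
def moveProb {n : ℕ} {ε : ℝ} (r : ℝ) (x y : Site n ε) : ℝ :=
  if y ∈ reach r x then 1 / ((reach r x).card : ℝ) else 0

/-- The stationary distribution `π(x) = |Γ(x)| / ∑_y |Γ(y)|` of a node. -/
def nodeLaw {n : ℕ} {ε : ℝ} (r : ℝ) (x : Site n ε) : ℝ :=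
  ((reach r x).card : ℝ) / ∑ y : Site n ε, ((reach r y).card : ℝ)

/-- The positions of all `n` nodes. -/
abbrev Config (n : ℕ) (ε : ℝ) : Type := Fin n → Site n ε

/-- All nodes move simultaneously and independently. -/
def configMoveProb {n : ℕ} {ε : ℝ} (r : ℝ) (x y : Config n ε) : ℝ :=
  ∏ i, moveProb r (x i) (y i)

/-- The nodes are independent, each with the stationary distribution `π`. -/
def configLaw {n : ℕ} {ε : ℝ} (r : ℝ) (x : Config n ε) : ℝ :=
  ∏ i, nodeLaw r (x i)

/-- Two nodes are joined when their Euclidean distance is at most the transmission radius. -/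
def proximityGraph {n : ℕ} {ε : ℝ} (R : ℝ) (x : Config n ε) : SimpleGraph (Fin n) where
  Adj i j := i ≠ j ∧ dist (x i).point (x j).point ≤ R
  symm := ⟨fun _ _ h => ⟨h.1.symm, by rw [dist_comm]; exact h.2⟩⟩
  loopless := ⟨fun _ h => h.1 rfl⟩

/-- `G` is (a version of) the stationary geometric-MEG `𝒢(n, r, R, ε)` on the probability
space `(Ω, μ)`: it is the proximity graph of `n` nodes moving as independent random walks on
the grid, the initial positions having the stationary distribution. -/
def IsStationaryGeometricMEG {Ω : Type*} [MeasurableSpace Ω] (μ : Measure Ω)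
    (n : ℕ) (r R ε : ℝ) (G : ℕ → Ω → SimpleGraph (Fin n)) : Prop :=
  ∃ P : ℕ → Ω → Config n ε,
    IsMarkovChain μ (configLaw r) (configMoveProb r) P ∧
    ∀ t ω, G t ω = proximityGraph R (P t ω)

/-- The law used for the initial positions is indeed a stationary distribution. -/
theorem configLaw_isStationary {n : ℕ} {ε r : ℝ} (hr : 0 ≤ r) :
    IsStationaryDistribution (configMoveProb (n := n) (ε := ε) r) (configLaw r) := by
  have hpos : ∀ x : Site n ε, (0 : ℝ) < ((reach r x).card : ℝ) := by
    intro x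
    have : x ∈ reach r x := by simp [reach, hr]
    exact_mod_cast Finset.card_pos.mpr ⟨x, this⟩
  have hZ : (0 : ℝ) < ∑ y : Site n ε, ((reach r y).card : ℝ) :=
    Finset.sum_pos (fun x _ => hpos x) ⟨(0, 0), Finset.mem_univ _⟩
  have hone : ∑ x : Site n ε, nodeLaw r x = 1 := by
    simp only [nodeLaw]
    rw [← Finset.sum_div]
    exact div_self hZ.ne'
  have hinv : ∀ y : Site n ε, ∑ x : Site n ε, nodeLaw r x * moveProb r x y = nodeLaw r y := by
    intro y
    have h1 : ∀ x : Site n ε, nodeLaw r x * moveProb r x y =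
        (if x ∈ reach r y then 1 else 0) / ∑ z : Site n ε, ((reach r z).card : ℝ) := by
      intro x
      have hs : y ∈ reach r x ↔ x ∈ reach r y := by simp [reach, dist_comm]
      have hx := (hpos x).ne'
      by_cases h : x ∈ reach r y
      · rw [nodeLaw, moveProb, if_pos (hs.2 h), if_pos h, div_mul_div_comm, mul_one,
          div_mul_cancel_right₀ hx, one_div]
      · rw [moveProb, if_neg (fun h' => h (hs.1 h')), if_neg h, mul_zero, zero_div]
    rw [Finset.sum_congr rfl (fun x _ => h1 x), ← Finset.sum_div]
    rw [nodeLaw, Finset.sum_ite_mem, Finset.univ_inter, Finset.sum_const, nsmul_eq_mul, mul_one]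
  refine ⟨fun x => Finset.prod_nonneg fun i _ => div_nonneg (hpos _).le hZ.le, ?_, ?_⟩
  · have := Finset.prod_univ_sum (fun _ : Fin n => (Finset.univ : Finset (Site n ε)))
      (fun _ x => nodeLaw r x)
    simp only [hone, Finset.prod_const_one, Fintype.piFinset_univ] at this
    exact this.symm
  · intro y
    have := Finset.prod_univ_sum (fun _ : Fin n => (Finset.univ : Finset (Site n ε)))
      (fun i x => nodeLaw r x * moveProb r x (y i))
    simp only [hinv, Fintype.piFinset_univ, Finset.prod_mul_distrib] at this
    exact this.symm

end

/-! Cut the square into `m × m` cells with `m = ⌈4√n/R⌉`, so that nodes in touching cells are always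
adjacent. The stationary law of a node is within a factor 16 of uniform (`card_reach_le`), so at any
fixed time each cell expects order `n/m²`, at least of order `log n`, nodes. A Chernoff bound for
the product law and a union bound over cells and over `32768 m + 1` times keep all cells evenly
populated. Only the one-time marginals matter: no mixing and no independence between times is used.

The rest is deterministic. Upper bound: the cells holding informed nodes have a boundary `B`, all of
whose nodes become informed. By isoperimetry (`card_le_sq_of_separates`), `|B|²` is at least the
number of cells on one side of it, so either the square root of the informed count rises, or that of
the uninformed count falls, by order `√n/m`. Hence the potential `√|I| - √|Iᶜ|`, confined to `[-√n,
√n]`, gains that much per step and flooding ends within `O(m)` steps.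

Lower bound: information travels at most `R + r` per step and a target at most `r`, while two nodes
start at distance at least `√n/2`; with `r ≤ KR` this forces `T` to be of order at least `√n/R`. -/

/-! ### Isoperimetry on the board and the deterministic upper bound. -/

/-- Cells of an `m × m` board that coincide or touch (possibly at a corner). -/
def CellNear {m : ℕ} (c d : Fin m × Fin m) : Prop :=
  ((c.1 : ℕ) ≤ d.1 + 1 ∧ (d.1 : ℕ) ≤ c.1 + 1) ∧ (c.2 : ℕ) ≤ d.2 + 1 ∧ (d.2 : ℕ) ≤ c.2 + 1

theorem Fin.forall_of_adjacent {m : ℕ} {P : Fin m → Prop}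
    (h : ∀ a b : Fin m, (a : ℕ) ≤ b + 1 → (b : ℕ) ≤ a + 1 → P a → P b) {a : Fin m} (ha : P a)
    (b : Fin m) : P b := by
  have key : ∀ k : ℕ, ∀ b : Fin m, (b : ℕ) = a + k ∨ (a : ℕ) = b + k → P b := by
    intro k
    induction k with
    | zero =>
      intro b hb
      have : b = a := Fin.ext (by omega)
      exact this ▸ ha
    | succ k ih =>
      intro b hb
      rcases hb with hb | hb
      · have hlt : (a : ℕ) + k < m := by omega
        exact h ⟨a + k, hlt⟩ b (by simp; omega) (by simp; omega) (ih _ (Or.inl rfl))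
      · have hlt : (b : ℕ) + 1 < m := by omega
        exact h ⟨b + 1, hlt⟩ b (by simp) (by simp; omega) (ih _ (Or.inr (by simp; omega)))
  rcases le_total (a : ℕ) b with hab | hab
  · exact key (b - a) b (Or.inl (by omega))
  · exact key (a - b) b (Or.inr (by omega))

/-- Vertex isoperimetry on the square board: a set of cells separating `S` from `Q` has at least
`√(min |S| |Q|)` elements. -/
theorem card_le_sq_of_separates {m : ℕ} {S B Q : Finset (Fin m × Fin m)}
    (hB : ∀ c ∈ S, ∀ d, CellNear c d → d ∈ S ∪ B) (hQS : Disjoint Q S) :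
    S.card ≤ B.card ^ 2 ∨ Q.card ≤ B.card ^ 2 := by
  -- A row that avoids `B` lies wholly inside or wholly outside `S`; likewise for columns.
  have hrow : ∀ i, i ∉ B.image Prod.fst → ∀ j, (i, j) ∈ S → ∀ j', (i, j') ∈ S := by
    intro i hi j hj j'
    refine Fin.forall_of_adjacent (P := fun j => (i, j) ∈ S) (fun a b h1 h2 ha => ?_) hj j'
    rcases Finset.mem_union.1 (hB _ ha (i, b) ⟨by simp, h1, h2⟩) with h | h
    · exact h
    · exact absurd (Finset.mem_image_of_mem Prod.fst h) hi
  have hcol : ∀ j, j ∉ B.image Prod.snd → ∀ i, (i, j) ∈ S → ∀ i', (i', j) ∈ S := by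
    intro j hj i hi i'
    refine Fin.forall_of_adjacent (P := fun i => (i, j) ∈ S) (fun a b h1 h2 ha => ?_) hi i'
    rcases Finset.mem_union.1 (hB _ ha (b, j) ⟨⟨h1, h2⟩, by simp⟩) with h | h
    · exact h
    · exact absurd (Finset.mem_image_of_mem Prod.snd h) hj
  have hbox : ∀ X : Finset (Fin m × Fin m),
      X ⊆ B.image Prod.fst ×ˢ B.image Prod.snd → X.card ≤ B.card ^ 2 := by
    intro X hX
    calc X.card ≤ (B.image Prod.fst ×ˢ B.image Prod.snd).card := Finset.card_le_card hX
      _ = (B.image Prod.fst).card * (B.image Prod.snd).card := Finset.card_product _ _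
      _ ≤ B.card * B.card := Nat.mul_le_mul Finset.card_image_le Finset.card_image_le
      _ = B.card ^ 2 := (sq _).symm
  have hall : m ≤ B.card → S.card ≤ B.card ^ 2 := fun h => by
    calc S.card ≤ Fintype.card (Fin m × Fin m) := Finset.card_le_univ S
      _ = m * m := by simp
      _ ≤ B.card ^ 2 := by rw [sq]; exact Nat.mul_le_mul h h
  by_cases h1 : ∃ i, i ∉ B.image Prod.fst
  swap
  · left
    push Not at h1
    refine hall ?_
    calc m = (Finset.univ : Finset (Fin m)).card := by simp
      _ ≤ (B.image Prod.fst).card := Finset.card_le_card fun i _ => h1 i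
      _ ≤ B.card := Finset.card_image_le
  by_cases h2 : ∃ j, j ∉ B.image Prod.snd
  swap
  · left
    push Not at h2
    refine hall ?_
    calc m = (Finset.univ : Finset (Fin m)).card := by simp
      _ ≤ (B.image Prod.snd).card := Finset.card_le_card fun i _ => h2 i
      _ ≤ B.card := Finset.card_image_le
  obtain ⟨i, hi⟩ := h1
  obtain ⟨j, hj⟩ := h2
  -- A row and a column avoiding `B` cross at `(i, j)`. Whether that cell is in `S` decides every
  -- other row and column avoiding `B`, so `Q` or `S` is trapped in the box of rows and columns that
  -- meet `B`.
  by_cases hij : (i, j) ∈ S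
  · right
    refine hbox Q fun c hc => ?_
    have hcS : c ∉ S := Finset.disjoint_left.1 hQS hc
    rw [Finset.mem_product]
    constructor
    · by_contra hcon
      exact hcS (hrow c.1 hcon j (hcol j hj i hij c.1) c.2)
    · by_contra hcon
      exact hcS (hcol c.2 hcon i (hrow i hi j hij c.2) c.1)
  · left
    refine hbox S fun c hc => ?_
    rw [Finset.mem_product]
    constructor
    · by_contra hcon
      exact hij (hcol j hj c.1 (hrow c.1 hcon c.2 hc j) i)
    · by_contra hcon
      exact hij (hrow i hi c.2 (hcol c.2 hcon c.1 hc i) j)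

/-- In `(√a + x)² = a + 2x√a + x²` each of the last two terms is at most `lo * k / 2`. Here `k` is
the number of boundary cells and `a` the node count on the side with at most `k²` cells. -/
theorem sqrt_add_le_sqrt_of_growth {a b k lo hi x : ℝ} (ha : 0 ≤ a) (hlo : 0 ≤ lo) (hhi : 0 ≤ hi)
    (hx : 0 ≤ x) (hk : 1 ≤ k) (hak : a ≤ hi * k ^ 2) (hab : a + lo * k ≤ b)
    (hx1 : 4 * x * √hi ≤ lo) (hx2 : 2 * x ^ 2 ≤ lo) : √a + x ≤ √b := by
  refine Real.le_sqrt_of_sq_le ?_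
  have h1 : √a ≤ √hi * k := by
    rw [← Real.sqrt_sq (by linarith : (0 : ℝ) ≤ k), ← Real.sqrt_mul hhi]
    exact Real.sqrt_le_sqrt hak
  have h2 : 4 * x * √a ≤ lo * k := by
    calc 4 * x * √a ≤ 4 * x * (√hi * k) := by gcongr
      _ = 4 * x * √hi * k := by ring
      _ ≤ lo * k := by gcongr
  have h3 : lo ≤ lo * k := le_mul_of_one_le_right hlo hk
  have h4 := Real.sq_sqrt ha
  nlinarith

/-- One flooding step when every cell contains between `lo` and `hi` nodes. -/
theorem flooding_step {V : Type*} [Fintype V] [DecidableEq V] {m : ℕ} {cell : V → Fin m × Fin m}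
    {lo hi x : ℝ} (hlo0 : 0 ≤ lo) (hhi0 : 0 ≤ hi)
    (hlo : ∀ c, lo ≤ ((Finset.univ.filter fun v => cell v = c).card : ℝ))
    (hhi : ∀ c, ((Finset.univ.filter fun v => cell v = c).card : ℝ) ≤ hi)
    (hx : 0 ≤ x) (hx1 : 4 * x * √hi ≤ lo) (hx2 : 2 * x ^ 2 ≤ lo)
    {I J : Finset V} (hI : I.Nonempty) (hIJ : I ⊆ J)
    (hJ : ∀ u ∈ I, ∀ v, CellNear (cell u) (cell v) → v ∈ J) (hJu : J ≠ Finset.univ) :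
    √(I.card : ℝ) - √(Iᶜ.card : ℝ) + x ≤ √(J.card : ℝ) - √(Jᶜ.card : ℝ) := by
  classical
  set S := I.image cell with hS
  set B := (Finset.univ.filter fun d => ∃ c ∈ S, CellNear c d) \ S with hB
  set Q := (S ∪ B)ᶜ with hQ
  have hfib : ∀ A : Finset (Fin m × Fin m), ((Finset.univ.filter fun v => cell v ∈ A).card : ℝ) =
      ∑ c ∈ A, ((Finset.univ.filter fun v => cell v = c).card : ℝ) := by
    intro A
    rw [Finset.card_eq_sum_card_fiberwise (f := cell) (t := A) (fun v hv => by simpa using hv)]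
    push_cast
    refine Finset.sum_congr rfl fun c hc => ?_
    congr 2
    ext v
    simp only [Finset.mem_filter, Finset.mem_univ, true_and]
    exact ⟨fun h => h.2, fun h => ⟨h ▸ hc, h⟩⟩
  have hfib_le : ∀ A : Finset (Fin m × Fin m),
      ((Finset.univ.filter fun v => cell v ∈ A).card : ℝ) ≤ hi * A.card := by
    intro A
    rw [hfib, mul_comm, ← nsmul_eq_mul]
    exact Finset.sum_le_card_nsmul _ _ _ fun c _ => hhi c
  have hle_fib : ∀ A : Finset (Fin m × Fin m),
      lo * A.card ≤ ((Finset.univ.filter fun v => cell v ∈ A).card : ℝ) := by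
    intro A
    rw [hfib, mul_comm, ← nsmul_eq_mul]
    exact Finset.card_nsmul_le_sum _ _ _ fun c _ => hlo c
  have hnear : ∀ c ∈ S, ∀ d, CellNear c d → d ∈ S ∪ B := by
    intro c hc d hd
    by_cases h : d ∈ S
    · exact Finset.mem_union_left _ h
    · refine Finset.mem_union_right _ ?_
      simp only [hB, Finset.mem_sdiff, Finset.mem_filter, Finset.mem_univ, true_and]
      exact ⟨⟨c, hc, hd⟩, h⟩
  have hIS : (I.card : ℝ) ≤ hi * S.card := by
    refine le_trans ?_ (hfib_le S)
    exact_mod_cast Finset.card_le_card fun v hv => by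
      simp only [Finset.mem_filter, Finset.mem_univ, true_and]
      exact Finset.mem_image_of_mem cell hv
  have hmemJ : ∀ v, cell v ∈ S ∪ B → v ∈ J := by
    intro v hv
    have : ∃ c ∈ S, CellNear c (cell v) := by
      rcases Finset.mem_union.1 hv with h | h
      · exact ⟨cell v, h, by simp [CellNear]⟩
      · simp only [hB, Finset.mem_sdiff, Finset.mem_filter, Finset.mem_univ, true_and] at h
        exact h.1
    obtain ⟨c, hc, hcv⟩ := this
    obtain ⟨u, hu, rfl⟩ := Finset.mem_image.1 hc
    exact hJ u hu v hcv
  have hJQ : (Jᶜ.card : ℝ) ≤ hi * Q.card := by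
    refine le_trans ?_ (hfib_le Q)
    exact_mod_cast Finset.card_le_card fun v hv => by
      simp only [Finset.mem_filter, Finset.mem_univ, true_and, hQ]
      rw [Finset.mem_compl] at hv ⊢
      exact fun h => hv (hmemJ v h)
  -- Cells of `B` are outside `S`, so they hold no node of `I`, yet all their nodes enter `J`.
  have hgrow : (I.card : ℝ) + lo * B.card ≤ J.card := by
    have hdisj : Disjoint I (Finset.univ.filter fun v => cell v ∈ B) := by
      rw [Finset.disjoint_left]
      intro v hv hv'
      simp only [hB, Finset.mem_sdiff, Finset.mem_filter, Finset.mem_univ, true_and] at hv'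
      exact hv'.2 (Finset.mem_image_of_mem cell hv)
    have hsub : I ∪ (Finset.univ.filter fun v => cell v ∈ B) ⊆ J := by
      refine Finset.union_subset hIJ fun v hv => hmemJ v (Finset.mem_union_right _ ?_)
      simpa using hv
    have h := Finset.card_le_card hsub
    rw [Finset.card_union_of_disjoint hdisj] at h
    have h' : (I.card : ℝ) + ((Finset.univ.filter fun v => cell v ∈ B).card : ℝ) ≤ J.card := by
      exact_mod_cast h
    linarith [hle_fib B]
  have hgrow' : (Jᶜ.card : ℝ) + lo * B.card ≤ Iᶜ.card := by
    have h1 : (I.card : ℝ) + Iᶜ.card = Fintype.card V := by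
      exact_mod_cast Finset.card_add_card_compl I
    have h2 : (J.card : ℝ) + Jᶜ.card = Fintype.card V := by
      exact_mod_cast Finset.card_add_card_compl J
    linarith
  have hS1 : 1 ≤ S.card := Finset.card_pos.2 (hI.image _)
  have hQ1 : 1 ≤ Q.card := by
    obtain ⟨v, hv⟩ : ∃ v, v ∉ J := by
      by_contra hcon
      push Not at hcon
      exact hJu (Finset.eq_univ_of_forall hcon)
    exact Finset.card_pos.2 ⟨cell v, by
      rw [hQ, Finset.mem_compl]; exact fun h => hv (hmemJ v h)⟩
  have hlB : 0 ≤ lo * (B.card : ℝ) := by positivity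
  have hQS : Disjoint Q S := by
    rw [Finset.disjoint_left]
    intro c hc hcS
    rw [hQ, Finset.mem_compl] at hc
    exact hc (Finset.mem_union_left _ hcS)
  have hB1 : S.card ≤ B.card ^ 2 ∨ Q.card ≤ B.card ^ 2 := card_le_sq_of_separates hnear hQS
  have hk : (1 : ℝ) ≤ B.card := by
    have : 1 ≤ B.card ^ 2 := by omega
    have : B.card ≠ 0 := by rintro h; simp [h] at this
    exact_mod_cast Nat.one_le_iff_ne_zero.2 this
  rcases hB1 with h | h
  · have h' : (S.card : ℝ) ≤ (B.card : ℝ) ^ 2 := by exact_mod_cast h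
    have := sqrt_add_le_sqrt_of_growth (Nat.cast_nonneg I.card) hlo0 hhi0 hx hk
      (hIS.trans (by gcongr)) hgrow hx1 hx2
    have h2 : √(Jᶜ.card : ℝ) ≤ √(Iᶜ.card : ℝ) := Real.sqrt_le_sqrt (by linarith)
    linarith
  -- The same growth estimate read backwards in time: the uninformed set grows from `Jᶜ` to `Iᶜ`.
  · have h' : (Q.card : ℝ) ≤ (B.card : ℝ) ^ 2 := by exact_mod_cast h
    have := sqrt_add_le_sqrt_of_growth (Nat.cast_nonneg Jᶜ.card) hlo0 hhi0 hx hk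
      (hJQ.trans (by gcongr)) hgrow' hx1 hx2
    have h2 : √(I.card : ℝ) ≤ √(J.card : ℝ) := Real.sqrt_le_sqrt (by linarith)
    linarith

theorem source_mem_informed {V : Type*} (G : ℕ → SimpleGraph V) (s : V) (t : ℕ) :
    s ∈ informed G s t := by
  induction t with
  | zero => exact Set.mem_singleton s
  | succ t ih => exact Or.inl ih

theorem informed_mono {V : Type*} (G : ℕ → SimpleGraph V) (s : V) : Monotone (informed G s) :=
  monotone_nat_of_le_succ fun _ => Set.subset_union_left

/-- If during `T` steps all cells are evenly populated, flooding is complete at time `T`. -/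
theorem floodingTime_le_of_cells {V : Type*} [Fintype V] {m : ℕ}
    {G : ℕ → SimpleGraph V} {cell : ℕ → V → Fin m × Fin m} {lo hi x : ℝ} (T : ℕ)
    (hlo0 : 0 ≤ lo) (hhi0 : 0 ≤ hi)
    (hlo : ∀ t < T, ∀ c, lo ≤ ({v | cell t v = c}.ncard : ℝ))
    (hhi : ∀ t < T, ∀ c, ({v | cell t v = c}.ncard : ℝ) ≤ hi)
    (hadj : ∀ t < T, ∀ u v, u ≠ v → CellNear (cell t u) (cell t v) → (G t).Adj u v)
    (hx : 0 ≤ x) (hx1 : 4 * x * √hi ≤ lo) (hx2 : 2 * x ^ 2 ≤ lo)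
    (hT : 2 * √(Fintype.card V : ℝ) < T * x) : floodingTime G ≤ T := by
  classical
  refine iSup_le fun s => ?_
  refine iInf₂_le_of_le T ?_ le_rfl
  by_contra hne
  set I : ℕ → Finset V := fun t => Finset.univ.filter (· ∈ informed G s t) with hI
  have hIne : ∀ t ≤ T, I t ≠ Finset.univ := by
    intro t ht h
    refine hne (Set.eq_univ_of_forall fun v => informed_mono G s ht ?_)
    have : v ∈ I t := h ▸ Finset.mem_univ v
    simpa [hI] using this
  -- The potential starts at or above `-√|V|` and never exceeds `√|V|`, which contradicts `hT` at
  -- time `T`.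
  have hpot : ∀ t ≤ T, -√(Fintype.card V : ℝ) + t * x ≤
      √((I t).card : ℝ) - √((I t)ᶜ.card : ℝ) := by
    intro t
    induction t with
    | zero =>
      intro _
      have h1 : √((I 0)ᶜ.card : ℝ) ≤ √(Fintype.card V : ℝ) :=
        Real.sqrt_le_sqrt (by exact_mod_cast Finset.card_le_univ _)
      have h2 := Real.sqrt_nonneg ((I 0).card : ℝ)
      push_cast
      linarith
    | succ t ih =>
      intro ht
      have hcard : ∀ c, (({v | cell t v = c}.ncard : ℕ) : ℝ) =
          ((Finset.univ.filter fun v => cell t v = c).card : ℝ) := by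
        intro c
        rw [Set.ncard_eq_toFinset_card']
        simp
      have := flooding_step (cell := cell t) (I := I t) (J := I (t + 1)) hlo0 hhi0
        (fun c => (hcard c) ▸ hlo t (by omega) c) (fun c => (hcard c) ▸ hhi t (by omega) c)
        hx hx1 hx2 ⟨s, by simpa [hI] using source_mem_informed G s t⟩
        (fun v hv => by
          simp only [hI, Finset.mem_filter, Finset.mem_univ, true_and] at hv ⊢
          exact informed_mono G s (Nat.le_succ t) hv)
        (fun u hu v huv => by
          simp only [hI, Finset.mem_filter, Finset.mem_univ, true_and] at hu ⊢
          by_cases hv : v ∈ informed G s t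
          · exact Or.inl hv
          · exact Or.inr ⟨hv, u, hu, hadj t (by omega) u v (by rintro rfl; exact hv hu) huv⟩)
        (hIne _ ht)
      have := ih (by omega)
      push_cast
      linarith
  have h1 := hpot T le_rfl
  have h2 : √((I T).card : ℝ) ≤ √(Fintype.card V : ℝ) :=
    Real.sqrt_le_sqrt (by exact_mod_cast Finset.card_le_univ _)
  have h3 := Real.sqrt_nonneg ((I T)ᶜ.card : ℝ)
  linarith

/-! ### Chernoff bound for product laws. -/

section Chernoff

variable {σ : Type*} [Fintype σ]

open Classical in
theorem sum_prod_mul_exp_le {q : σ → ℝ} (hq : ∀ s, 0 ≤ q s) (hq1 : ∑ s, q s = 1) (A : Set σ)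
    (n : ℕ) (θ : ℝ) :
    ∑ x : Fin n → σ, (∏ i, q (x i)) * Real.exp (θ * ({i | x i ∈ A}.ncard : ℝ)) ≤
      Real.exp (n * (∑ s with s ∈ A, q s) * (Real.exp θ - 1)) := by
  have h1 : ∀ x : Fin n → σ, (∏ i, q (x i)) * Real.exp (θ * ({i | x i ∈ A}.ncard : ℝ)) =
      ∏ i, (q (x i) * if x i ∈ A then Real.exp θ else 1) := by
    intro x
    rw [Finset.prod_mul_distrib, Finset.prod_ite, Finset.prod_const, Finset.prod_const_one,
      mul_one, ← Real.exp_nat_mul, Set.ncard_eq_toFinset_card', mul_comm θ]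
    simp
  -- The exponential moment factors into the `n`-th power of a one-node moment `1 + p (exp θ - 1)`,
  -- which `1 + y ≤ exp y` bounds.
  rw [Finset.sum_congr rfl fun x _ => h1 x,
    ← Fintype.sum_pow (fun s => q s * if s ∈ A then Real.exp θ else 1)]
  have h2 : ∑ s, (q s * if s ∈ A then Real.exp θ else 1) =
      (∑ s with s ∈ A, q s) * (Real.exp θ - 1) + 1 := by
    have h3 : ∀ s, (q s * if s ∈ A then Real.exp θ else 1) =
        (if s ∈ A then q s else 0) * (Real.exp θ - 1) + q s := fun s => by split_ifs <;> ring
    simp only [h3]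
    rw [Finset.sum_add_distrib, hq1, ← Finset.sum_mul, Finset.sum_filter]
  rw [h2, mul_assoc, Real.exp_nat_mul]
  refine pow_le_pow_left₀ ?_ (Real.add_one_le_exp _) n
  rw [← h2]
  exact Finset.sum_nonneg fun s _ => mul_nonneg (hq s) (by split_ifs <;> positivity)

open Classical in
/-- Exponential Markov inequality for the number of coordinates in `A` under a product law. -/
theorem sum_prod_filter_le_exp {q : σ → ℝ} (hq : ∀ s, 0 ≤ q s) (hq1 : ∑ s, q s = 1) (A : Set σ)
    (n : ℕ) (θ b : ℝ) :
    ∑ x : Fin n → σ with b ≤ θ * ({i | x i ∈ A}.ncard : ℝ), ∏ i, q (x i) ≤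
      Real.exp (n * (∑ s with s ∈ A, q s) * (Real.exp θ - 1) - b) := by
  rw [sub_eq_add_neg, Real.exp_add]
  refine le_trans ?_
    (mul_le_mul_of_nonneg_right (sum_prod_mul_exp_le hq hq1 A n θ) (Real.exp_pos (-b)).le)
  rw [Finset.sum_mul]
  have hprod : ∀ x : Fin n → σ, 0 ≤ ∏ i, q (x i) := fun x => Finset.prod_nonneg fun i _ => hq _
  refine le_trans (Finset.sum_le_sum fun x hx => ?_)
    (Finset.sum_le_sum_of_subset_of_nonneg (Finset.filter_subset _ _) fun x _ _ =>
      mul_nonneg (mul_nonneg (hprod x) (Real.exp_pos _).le) (Real.exp_pos _).le)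
  rw [mul_assoc, ← Real.exp_add]
  refine le_mul_of_one_le_right (hprod x) (Real.one_le_exp ?_)
  have := (Finset.mem_filter.1 hx).2
  linarith

end Chernoff

/-! ### One-time marginals and almost sure transitions of a stationary chain. -/

section Markov

variable {Ω S : Type*} [MeasurableSpace Ω] [MeasurableSpace S] [MeasurableSingletonClass S]
  {μ : Measure Ω} {p : S → ℝ} {K : S → S → ℝ} {X : ℕ → Ω → S}

theorem IsMarkovChain.measurableSet_path (h : IsMarkovChain μ p K X) (j t : ℕ) (x : ℕ → S) :
    MeasurableSet {ω | ∀ s, j ≤ s → s ≤ t → X s ω = x s} := by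
  simp only [Set.ofPred_forall]
  exact MeasurableSet.iInter fun s => MeasurableSet.iInter fun _ => MeasurableSet.iInter fun _ =>
    h.measurable s (measurableSet_singleton (x s))

variable [Fintype S] [IsProbabilityMeasure μ]

theorem measureReal_eq_sum_fiber {X : Ω → S} (hX : Measurable X) {A : Set Ω}
    (hA : MeasurableSet A) : μ.real A = ∑ z, μ.real (A ∩ {ω | X ω = z}) := by
  classical
  have hU : A = ⋃ z ∈ (Finset.univ : Finset S), A ∩ {ω | X ω = z} := by
    ext ω; simp
  conv_lhs => rw [hU]
  refine measureReal_biUnion_finset ?_ fun z _ => hA.inter (hX (measurableSet_singleton z))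
  intro a _ b _ hab
  refine Set.disjoint_left.2 fun ω h1 h2 => hab ?_
  exact h1.2.symm.trans h2.2

/-- `IsMarkovChain.step` fixes the whole history; summing over the state at time `j` forgets that
history one time at a time. -/
theorem IsMarkovChain.path_step (h : IsMarkovChain μ p K X) (t j : ℕ) (hj : j ≤ t) (x : ℕ → S) :
    μ.real {ω | ∀ s, j ≤ s → s ≤ t + 1 → X s ω = x s} =
      μ.real {ω | ∀ s, j ≤ s → s ≤ t → X s ω = x s} * K (x t) (x (t + 1)) := by
  classical
  induction j generalizing x with
  | zero => simpa using h.step t x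
  | succ j ih =>
    have hset : ∀ t', j + 1 ≤ t' → ∀ z, {ω | ∀ s, j + 1 ≤ s → s ≤ t' → X s ω = x s} ∩
        {ω | X j ω = z} = {ω | ∀ s, j ≤ s → s ≤ t' → X s ω = Function.update x j z s} := by
      intro t' ht' z
      ext ω
      simp only [Set.mem_inter_iff, Set.mem_ofPred_eq]
      constructor
      · rintro ⟨h1, h2⟩ s hs hs'
        rcases hs.eq_or_lt with rfl | hlt
        · simpa using h2
        · rw [Function.update_of_ne hlt.ne']
          exact h1 s hlt hs'
      · intro h1
        refine ⟨fun s hs hs' => ?_, by simpa using h1 j le_rfl (by omega)⟩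
        have := h1 s (by omega) hs'
        rwa [Function.update_of_ne (by omega)] at this
    rw [measureReal_eq_sum_fiber (h.measurable j) (h.measurableSet_path (j + 1) (t + 1) x),
      measureReal_eq_sum_fiber (h.measurable j) (h.measurableSet_path (j + 1) t x),
      Finset.sum_mul]
    refine Finset.sum_congr rfl fun z _ => ?_
    rw [hset _ (by omega), hset _ hj, ih (by omega) (Function.update x j z),
      Function.update_of_ne (by omega), Function.update_of_ne (by omega)]

theorem IsMarkovChain.transition (h : IsMarkovChain μ p K X) (t : ℕ) (x y : S) :
    μ.real ({ω | X (t + 1) ω = y} ∩ {ω | X t ω = x}) = μ.real {ω | X t ω = x} * K x y := by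
  have := h.path_step t t le_rfl (fun s => if s = t then x else y)
  simp only [if_true, Nat.succ_ne_self, if_false] at this
  convert this using 2
  · ext ω
    simp only [Set.mem_inter_iff, Set.mem_ofPred_eq]
    constructor
    · rintro ⟨h1, h2⟩ s hs hs'
      obtain rfl | rfl : s = t ∨ s = t + 1 := by omega
      · simpa using h2
      · simpa using h1
    · intro h1
      exact ⟨by simpa using h1 (t + 1) (by omega) le_rfl, by simpa using h1 t le_rfl (by omega)⟩
  · congr 1
    ext ω
    simp only [Set.mem_ofPred_eq]
    constructor
    · intro h1 s hs hs'
      obtain rfl : s = t := by omega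
      simpa using h1
    · intro h1
      simpa using h1 t le_rfl le_rfl

theorem IsMarkovChain.marginal (h : IsMarkovChain μ p K X) (hp : IsStationaryDistribution K p)
    (t : ℕ) (x : S) : μ.real {ω | X t ω = x} = p x := by
  induction t generalizing x with
  | zero => exact h.initial x
  | succ t ih =>
    rw [measureReal_eq_sum_fiber (h.measurable t)
      (A := {ω | X (t + 1) ω = x}) (h.measurable (t + 1) (measurableSet_singleton x)), ← hp.invariant x]
    exact Finset.sum_congr rfl fun z _ => by rw [h.transition, ih]

open Classical in
theorem IsMarkovChain.measureReal_mem (h : IsMarkovChain μ p K X)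
    (hp : IsStationaryDistribution K p) (t : ℕ) (A : Set S) :
    μ.real {ω | X t ω ∈ A} = ∑ x with x ∈ A, p x := by
  rw [measureReal_eq_sum_fiber (h.measurable t) (A := {ω | X t ω ∈ A}) (h.measurable t A.toFinite.measurableSet),
    Finset.sum_filter]
  refine Finset.sum_congr rfl fun z _ => ?_
  rw [← h.marginal hp t z]
  split_ifs with hz
  · congr 1
    ext ω
    simp only [Set.mem_inter_iff, Set.mem_ofPred_eq]
    exact ⟨fun h => h.2, fun h => ⟨h ▸ hz, h⟩⟩
  · convert measureReal_empty
    ext ω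
    simp only [Set.mem_inter_iff, Set.mem_ofPred_eq, Set.mem_empty_iff_false,
      iff_false]
    exact fun h => hz (h.2 ▸ h.1)

theorem IsMarkovChain.ae_transition_ne_zero (h : IsMarkovChain μ p K X) :
    ∀ᵐ ω ∂μ, ∀ t, K (X t ω) (X (t + 1) ω) ≠ 0 := by
  rw [ae_all_iff]
  intro t
  have : ∀ᵐ ω ∂μ, ∀ x y : S, K x y = 0 → ¬(X (t + 1) ω = y ∧ X t ω = x) := by
    rw [ae_all_iff]
    intro x
    rw [ae_all_iff]
    intro y
    by_cases hK : K x y = 0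
    · have h0 := h.transition t x y
      rw [hK, mul_zero, measureReal_eq_zero_iff] at h0
      have h1 := measure_eq_zero_iff_ae_notMem.1 h0
      filter_upwards [h1] with ω hω _ h2
      exact hω h2
    · exact Filter.Eventually.of_forall fun ω h => absurd h hK
  filter_upwards [this] with ω hω h0
  exact hω _ _ h0 ⟨rfl, rfl⟩

end Markov

/-! ### Comparison of the stationary law with the uniform law. -/

theorem dist_point_eq {n : ℕ} {ε : ℝ} (x y : Site n ε) : dist x.point y.point =
    √((((x.1 : ℕ) : ℝ) * ε - ((y.1 : ℕ) : ℝ) * ε) ^ 2 +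
      (((x.2 : ℕ) : ℝ) * ε - ((y.2 : ℕ) : ℝ) * ε) ^ 2) := by
  rw [EuclideanSpace.dist_eq, Fin.sum_univ_two, Real.dist_eq, Real.dist_eq, sq_abs, sq_abs]
  simp [Site.point]

section Transplant

variable {M : ℕ}

/-- Half of the displacement from `y` to `z`, transplanted to `x` in a direction with room. -/
def transplantHalf (x y z : Fin M) : Fin M :=
  let e := (((z : ℕ) - y) + ((y : ℕ) - z)) / 2
  -- As `2e < M`, a failure of `x + e < M` forces `e ≤ x`, so the truncated subtraction is exact.
  if h : (x : ℕ) + e < M then ⟨x + e, h⟩ else ⟨x - e, by omega⟩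

theorem transplantHalf_spec (x y z : Fin M) : ((transplantHalf x y z : ℕ) - (x : ℕ)) + ((x : ℕ) - (transplantHalf x y z : ℕ)) =
    (((z : ℕ) - y) + ((y : ℕ) - z)) / 2 := by
  have := x.2
  have := y.2
  have := z.2
  simp only [transplantHalf]
  split_ifs with h
  · simp
  · simp only
    simp only [not_lt] at h
    omega

/-- The image determines the displacement up to its sign and the parity lost in halving. -/
theorem card_transplantHalf_fiber_le (x y w : Fin M) :
    (Finset.univ.filter fun z => transplantHalf x y z = w).card ≤ 4 := by
  set e := ((w : ℕ) - x) + ((x : ℕ) - w) with he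
  have hsub : (Finset.univ.filter fun z => transplantHalf x y z = w).image (fun z : Fin M => (z : ℕ)) ⊆
      {(y : ℕ) + 2 * e, (y : ℕ) + 2 * e + 1, (y : ℕ) - 2 * e, (y : ℕ) - 2 * e - 1} := by
    intro k hk
    simp only [Finset.mem_image, Finset.mem_filter, Finset.mem_univ, true_and] at hk
    obtain ⟨z, hz, rfl⟩ := hk
    have := transplantHalf_spec x y z
    rw [hz] at this
    simp only [Finset.mem_insert, Finset.mem_singleton]
    omega
  rw [← Finset.card_image_of_injective _ Fin.val_injective]
  exact (Finset.card_le_card hsub).trans Finset.card_le_four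

theorem sq_transplantHalf_sub_le (x y z : Fin M) (ε : ℝ) :
    (((x : ℕ) : ℝ) * ε - ((transplantHalf x y z : ℕ) : ℝ) * ε) ^ 2 ≤
      (((y : ℕ) : ℝ) * ε - ((z : ℕ) : ℝ) * ε) ^ 2 := by
  have h := transplantHalf_spec x y z
  have h1 : |((x : ℕ) : ℤ) - (transplantHalf x y z : ℕ)| ≤ |((y : ℕ) : ℤ) - (z : ℕ)| := by
    generalize (transplantHalf x y z : ℕ) = w at h ⊢
    rw [Int.abs_eq_natAbs, Int.abs_eq_natAbs]
    omega
  have h2 : |((x : ℕ) : ℝ) - (transplantHalf x y z : ℕ)| ≤ |((y : ℕ) : ℝ) - (z : ℕ)| := by exact_mod_cast h1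
  rw [← sub_mul, ← sub_mul, mul_pow, mul_pow]
  exact mul_le_mul_of_nonneg_right (sq_le_sq.2 h2) (sq_nonneg ε)

end Transplant

/-- Halving each coordinate displacement lets a disc around `y` be mapped into the grid part of a
disc around `x`, even when `x` is at a corner. The map is at most 4-to-1 per coordinate, uniformly
in `r` and `ε`. -/
theorem card_reach_le {n : ℕ} {ε : ℝ} (r : ℝ) (x y : Site n ε) :
    (reach r y).card ≤ 16 * (reach r x).card := by
  classical
  refine Finset.card_le_mul_card_image_of_maps_to
    (f := fun z : Site n ε => (transplantHalf x.1 y.1 z.1, transplantHalf x.2 y.2 z.2)) ?_ 16 ?_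
  · intro z hz
    simp only [reach, Finset.mem_filter, Finset.mem_univ, true_and, dist_point_eq] at hz ⊢
    exact (Real.sqrt_le_sqrt (add_le_add (sq_transplantHalf_sub_le _ _ _ _) (sq_transplantHalf_sub_le _ _ _ _))).trans
      hz
  · intro w _
    calc _ ≤ ((Finset.univ.filter fun z => transplantHalf x.1 y.1 z = w.1) ×ˢ
          (Finset.univ.filter fun z => transplantHalf x.2 y.2 z = w.2)).card := by
            refine Finset.card_le_card fun z hz => ?_
            have := (Finset.mem_filter.1 hz).2
            simp [← this]
      _ ≤ 4 * 4 := by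
            rw [Finset.card_product]
            exact Nat.mul_le_mul (card_transplantHalf_fiber_le _ _ _) (card_transplantHalf_fiber_le _ _ _)

theorem sum_card_reach_pos {n : ℕ} {ε r : ℝ} (hr : 0 ≤ r) :
    0 < ∑ y : Site n ε, ((reach r y).card : ℝ) := by
  refine Finset.sum_pos (fun x _ => ?_) ⟨(0, 0), Finset.mem_univ _⟩
  exact_mod_cast Finset.card_pos.2 ⟨x, by simp [reach, hr]⟩

theorem nodeLaw_nonneg {n : ℕ} {ε r : ℝ} (hr : 0 ≤ r) (x : Site n ε) : 0 ≤ nodeLaw r x :=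
  div_nonneg (Nat.cast_nonneg _) (sum_card_reach_pos hr).le

theorem sum_nodeLaw {n : ℕ} {ε r : ℝ} (hr : 0 ≤ r) : ∑ x : Site n ε, nodeLaw r x = 1 := by
  simp only [nodeLaw]
  rw [← Finset.sum_div, div_self (sum_card_reach_pos hr).ne']

theorem le_nodeLaw {n : ℕ} {ε r : ℝ} (hr : 0 ≤ r) (x : Site n ε) :
    1 / (16 * (Fintype.card (Site n ε) : ℝ)) ≤ nodeLaw r x := by
  have hZ := sum_card_reach_pos (n := n) (ε := ε) hr
  have hM : (0 : ℝ) < Fintype.card (Site n ε) := by exact_mod_cast Fintype.card_pos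
  rw [nodeLaw, div_le_div_iff₀ (by positivity) hZ, one_mul]
  calc ∑ y : Site n ε, ((reach r y).card : ℝ) ≤ ∑ y : Site n ε, 16 * ((reach r x).card : ℝ) :=
        Finset.sum_le_sum fun y _ => by exact_mod_cast card_reach_le r x y
    _ = _ := by rw [Finset.sum_const, nsmul_eq_mul, Finset.card_univ]; ring

theorem nodeLaw_le {n : ℕ} {ε r : ℝ} (hr : 0 ≤ r) (x : Site n ε) :
    nodeLaw r x ≤ 16 / (Fintype.card (Site n ε) : ℝ) := by
  have hZ := sum_card_reach_pos (n := n) (ε := ε) hr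
  have hM : (0 : ℝ) < Fintype.card (Site n ε) := by exact_mod_cast Fintype.card_pos
  rw [nodeLaw, div_le_div_iff₀ hZ hM]
  calc ((reach r x).card : ℝ) * (Fintype.card (Site n ε) : ℝ)
      = ∑ y : Site n ε, ((reach r x).card : ℝ) := by
        rw [Finset.sum_const, nsmul_eq_mul, Finset.card_univ]; ring
    _ ≤ ∑ y : Site n ε, 16 * ((reach r y).card : ℝ) :=
        Finset.sum_le_sum fun y _ => by exact_mod_cast card_reach_le r y x
    _ = _ := by rw [Finset.mul_sum]

/-! ### Division of the grid into cells. -/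

/-- The index of the interval containing `i` when `M` points are split into `m` intervals. -/
def cellIndex {M m : ℕ} (hm : 0 < m) (i : Fin M) : Fin m :=
  ⟨(i : ℕ) * m / M, Nat.div_lt_of_lt_mul (Nat.mul_lt_mul_of_pos_right i.2 hm)⟩

theorem cellIndex_eq_iff {M m : ℕ} (hm : 0 < m) (i : Fin M) (j : Fin m) :
    cellIndex hm i = j ↔ (j : ℕ) * M ≤ i * m ∧ (i : ℕ) * m < (j + 1) * M := by
  have hM : 0 < M := i.pos
  rw [Fin.ext_iff, cellIndex]
  simp only
  rw [Nat.div_eq_iff hM, add_mul, one_mul]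
  omega

/-- The interval runs from `⌈jM/m⌉` to just below `⌈(j+1)M/m⌉`; `(a + m - 1) / m` is the ceiling of
`a/m`. -/
theorem card_cellIndex {M m : ℕ} (hm : 0 < m) (j : Fin m) :
    (Finset.univ.filter fun i : Fin M => cellIndex hm i = j).card =
      ((j + 1) * M + m - 1) / m - (j * M + m - 1) / m := by
  rw [← Finset.card_image_of_injective _ Fin.val_injective, ← Nat.card_Ico]
  congr 1
  have hle : ∀ a k : ℕ, (a + m - 1) / m ≤ k ↔ a ≤ k * m := by
    intro a k
    rw [← Nat.lt_succ_iff, Nat.div_lt_iff_lt_mul hm, Nat.succ_mul]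
    omega
  ext k
  simp only [Finset.mem_image, Finset.mem_filter, Finset.mem_univ, true_and, Finset.mem_Ico,
    cellIndex_eq_iff]
  rw [hle, ← not_le, hle, not_le]
  constructor
  · rintro ⟨i, h, rfl⟩
    exact h
  · intro h
    have hk : k < M := by
      have h1 : ((j : ℕ) + 1) * M ≤ m * M := Nat.mul_le_mul_right _ j.2
      have h2 : k * m < M * m := by rw [mul_comm M m]; exact h.2.trans_le h1
      exact lt_of_mul_lt_mul_right h2 (Nat.zero_le m)
    exact ⟨⟨k, hk⟩, h, rfl⟩

theorem card_cellIndex_bounds {M m : ℕ} (hm : 0 < m) (hM : 2 * m ≤ M) (j : Fin m) :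
    (M : ℝ) / (2 * m) ≤ ((Finset.univ.filter fun i : Fin M => cellIndex hm i = j).card : ℝ) ∧
      ((Finset.univ.filter fun i : Fin M => cellIndex hm i = j).card : ℝ) ≤ 2 * M / m := by
  have hm' : (0 : ℝ) < m := by exact_mod_cast hm
  rw [card_cellIndex hm, div_le_iff₀ (by positivity), le_div_iff₀ hm']
  have h1 := Nat.div_add_mod (((j : ℕ) + 1) * M + m - 1) m
  have h2 := Nat.div_add_mod ((j : ℕ) * M + m - 1) m
  have h3 := Nat.mod_lt (((j : ℕ) + 1) * M + m - 1) hm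
  have h4 := Nat.mod_lt ((j : ℕ) * M + m - 1) hm
  set a := (((j : ℕ) + 1) * M + m - 1) / m
  set b := ((j : ℕ) * M + m - 1) / m
  rw [add_mul, one_mul] at h1 h3
  have hab : b ≤ a := by
    by_contra hcon
    have : m * (a + 1) ≤ m * b := Nat.mul_le_mul_left _ (by omega)
    rw [mul_add, mul_one] at this
    omega
  obtain ⟨d, hd⟩ := Nat.exists_eq_add_of_le hab
  rw [hd, mul_add] at h1
  have h5 : M ≤ d * (2 * m) := by
    have : d * (2 * m) = 2 * (m * d) := by ring
    omega
  have h6 : d * m ≤ 2 * M := by rw [mul_comm]; omega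
  rw [hd, Nat.add_sub_cancel_left]
  exact ⟨by exact_mod_cast h5, by exact_mod_cast h6⟩

theorem cellIndex_dist {M m : ℕ} (hm : 0 < m) {i i' : Fin M}
    (h : (cellIndex hm i : ℕ) ≤ cellIndex hm i' + 1) (ε : ℝ) (hε : 0 ≤ ε) :
    ((i : ℕ) : ℝ) * ε - ((i' : ℕ) : ℝ) * ε ≤ 2 * (M * ε) / m := by
  have hm' : (0 : ℝ) < m := by exact_mod_cast hm
  have h1 := ((cellIndex_eq_iff hm i _).1 rfl).2
  have h2 := ((cellIndex_eq_iff hm i' _).1 rfl).1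
  have h3 : (cellIndex hm i + 1 : ℕ) * M ≤ (cellIndex hm i' + 2) * M :=
    Nat.mul_le_mul_right _ (by omega)
  have h4 : (i : ℕ) * m ≤ i' * m + 2 * M := by
    rw [add_mul (cellIndex hm i' : ℕ)] at h3
    omega
  have h5 : ((i : ℕ) : ℝ) * m ≤ (i' : ℕ) * m + 2 * M := by exact_mod_cast h4
  rw [le_div_iff₀ hm']
  nlinarith

/-- The cell of a site when the grid is divided into `m × m` cells. -/
noncomputable def gridCell {n : ℕ} {ε : ℝ} {m : ℕ} (hm : 0 < m) (x : Site n ε) : Fin m × Fin m :=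
  (cellIndex hm x.1, cellIndex hm x.2)

section Cells

variable {n m : ℕ} {ε : ℝ} (hm : 0 < m)

theorem dist_point_le_of_cellNear (hε : 0 < ε) {x y : Site n ε}
    (h : CellNear (gridCell hm x) (gridCell hm y)) :
    dist x.point y.point ≤ 3 * (√n + ε) / m := by
  have hm' : (0 : ℝ) < m := by exact_mod_cast hm
  have hM : ((⌊√(n : ℝ) / ε⌋₊ + 1 : ℕ) : ℝ) * ε ≤ √n + ε := by
    push_cast
    rw [add_mul, one_mul]
    have := Nat.floor_le (by positivity : 0 ≤ √(n : ℝ) / ε)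
    have := mul_le_mul_of_nonneg_right this hε.le
    rw [div_mul_cancel₀ _ hε.ne'] at this
    linarith
  have key : ∀ i i' : Fin (⌊√(n : ℝ) / ε⌋₊ + 1), (cellIndex hm i : ℕ) ≤ cellIndex hm i' + 1 →
      (cellIndex hm i' : ℕ) ≤ cellIndex hm i + 1 →
      (((i : ℕ) : ℝ) * ε - ((i' : ℕ) : ℝ) * ε) ^ 2 ≤ (2 * (√n + ε) / m) ^ 2 := by
    intro i i' h1 h2
    have h1 := cellIndex_dist hm h1 ε hε.le
    have h2 := cellIndex_dist hm h2 ε hε.le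
    have h3 : 2 * (((⌊√(n : ℝ) / ε⌋₊ + 1 : ℕ) : ℝ) * ε) / m ≤ 2 * (√n + ε) / m := by gcongr
    exact sq_le_sq' (by linarith) (by linarith)
  have h1 := key _ _ h.1.1 h.1.2
  have h2 := key _ _ h.2.1 h.2.2
  rw [dist_point_eq]
  refine Real.sqrt_le_iff.2 ⟨by positivity, ?_⟩
  -- The factor 3 is a rounding up of `2√2`.
  have h3 : (3 * (√n + ε) / m) ^ 2 = 9 / 4 * (2 * (√n + ε) / m) ^ 2 := by ring
  nlinarith [sq_nonneg (2 * (√n + ε) / m)]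

theorem le_dist_of_corner_cells (hm4 : 4 ≤ m) (hε : 0 < ε) {x y : Site n ε}
    (hx : (gridCell hm x).1 = ⟨0, hm⟩) (hy : (gridCell hm y).1 = ⟨m - 1, by omega⟩) :
    √n / 2 ≤ dist x.point y.point := by
  have hm' : (4 : ℝ) ≤ m := by exact_mod_cast hm4
  have h1 := ((cellIndex_eq_iff hm x.1 _).1 hx).2
  have h2 := ((cellIndex_eq_iff hm y.1 _).1 hy).1
  simp only [zero_add, one_mul] at h1 h2
  have h1' : (((x.1 : ℕ) : ℝ)) * m < ((⌊√(n : ℝ) / ε⌋₊ + 1 : ℕ) : ℝ) := by exact_mod_cast h1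
  have h2' : ((m : ℝ) - 1) * ((⌊√(n : ℝ) / ε⌋₊ + 1 : ℕ) : ℝ) ≤ ((y.1 : ℕ) : ℝ) * m := by
    have : ((m - 1 : ℕ) : ℝ) = (m : ℝ) - 1 := by rw [Nat.cast_sub (by omega)]; simp
    rw [← this]
    exact_mod_cast h2
  have hM : √n ≤ ((⌊√(n : ℝ) / ε⌋₊ + 1 : ℕ) : ℝ) * ε := by
    push_cast
    have := Nat.lt_floor_add_one (√(n : ℝ) / ε)
    rw [div_lt_iff₀ hε] at this
    exact this.le
  set M := ((⌊√(n : ℝ) / ε⌋₊ + 1 : ℕ) : ℝ)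
  have hM0 : 0 ≤ M := Nat.cast_nonneg _
  have h3 : M / 2 ≤ ((y.1 : ℕ) : ℝ) - ((x.1 : ℕ) : ℝ) := by
    by_contra hcon
    push Not at hcon
    nlinarith
  rw [dist_point_eq]
  refine Real.le_sqrt_of_sq_le ?_
  have h4 : √n / 2 ≤ ((y.1 : ℕ) : ℝ) * ε - ((x.1 : ℕ) : ℝ) * ε := by nlinarith
  have h5 := pow_le_pow_left₀ (by positivity) h4 2
  nlinarith [sq_nonneg (((x.2 : ℕ) : ℝ) * ε - ((y.2 : ℕ) : ℝ) * ε)]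

open Classical in
theorem sum_nodeLaw_cell_bounds (hM : 2 * m ≤ ⌊√(n : ℝ) / ε⌋₊ + 1) {r : ℝ} (hr : 0 ≤ r)
    (c : Fin m × Fin m) :
    1 / (64 * (m : ℝ) ^ 2) ≤ ∑ x : Site n ε with x ∈ {x | gridCell hm x = c}, nodeLaw r x ∧
      ∑ x : Site n ε with x ∈ {x | gridCell hm x = c}, nodeLaw r x ≤ 64 / (m : ℝ) ^ 2 := by
  have hm' : (0 : ℝ) < m := by exact_mod_cast hm
  have hfil : (Finset.univ.filter fun x : Site n ε => x ∈ {x | gridCell hm x = c}) =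
      (Finset.univ.filter fun i => cellIndex hm i = c.1) ×ˢ
        (Finset.univ.filter fun i => cellIndex hm i = c.2) := by
    ext x
    simp [gridCell, Prod.ext_iff]
  have hcard := congrArg (fun s => (s.card : ℝ)) hfil
  simp only [Finset.card_product, Nat.cast_mul] at hcard
  obtain ⟨a1, a2⟩ := card_cellIndex_bounds hm hM c.1
  obtain ⟨b1, b2⟩ := card_cellIndex_bounds hm hM c.2
  have hsite : (Fintype.card (Site n ε) : ℝ) = ((⌊√(n : ℝ) / ε⌋₊ + 1 : ℕ) : ℝ) ^ 2 := by
    rw [Fintype.card_prod, Fintype.card_fin, sq]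
    push_cast
    rfl
  have hMpos : (0 : ℝ) < ((⌊√(n : ℝ) / ε⌋₊ + 1 : ℕ) : ℝ) := by positivity
  set M := ((⌊√(n : ℝ) / ε⌋₊ + 1 : ℕ) : ℝ)
  constructor
  · refine le_trans ?_ (Finset.card_nsmul_le_sum _ _ _ fun x _ => le_nodeLaw hr x)
    rw [nsmul_eq_mul, hcard, hsite]
    calc 1 / (64 * (m : ℝ) ^ 2) = (M / (2 * m)) * (M / (2 * m)) * (1 / (16 * M ^ 2)) := by
          field_simp; norm_num
      _ ≤ _ := by gcongr
  · refine le_trans (Finset.sum_le_card_nsmul _ _ _ fun x _ => nodeLaw_le hr x) ?_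
    rw [nsmul_eq_mul, hcard, hsite]
    calc _ ≤ (2 * M / m) * (2 * M / m) * (16 / M ^ 2) := by gcongr
      _ = 64 / (m : ℝ) ^ 2 := by field_simp; norm_num

end Cells

/-! ### Even population of the cells with high probability. -/

section Probability

variable {Ω : Type*} [MeasurableSpace Ω] {μ : Measure Ω} [IsProbabilityMeasure μ]
  {n : ℕ} {r ε : ℝ} {P : ℕ → Ω → Config n ε}

/-- Tail bound for the number of nodes in a cell at a given time. -/
theorem measureReal_cell_count_le (hr : 0 ≤ r)
    (hP : IsMarkovChain μ (configLaw r) (configMoveProb r) P) {m : ℕ} (hm : 0 < m) (t : ℕ)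
    (c : Fin m × Fin m) (θ b : ℝ) :
    open Classical in
    μ.real {ω | b ≤ θ * ({v | gridCell hm (P t ω v) = c}.ncard : ℝ)} ≤
      Real.exp (n * (∑ x : Site n ε with x ∈ {x | gridCell hm x = c}, nodeLaw r x) *
        (Real.exp θ - 1) - b) := by
  classical
  have h1 := sum_prod_filter_le_exp (nodeLaw_nonneg hr) (sum_nodeLaw hr)
    {x : Site n ε | gridCell hm x = c} n θ b
  have h2 := hP.measureReal_mem (configLaw_isStationary hr) t
    {x | b ≤ θ * ({v | gridCell hm (x v) = c}.ncard : ℝ)}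
  simp only [Set.mem_ofPred_eq, configLaw] at h1 h2 ⊢
  rw [h2]
  exact h1

theorem measureReal_uneven_cells_le (hr : 0 ≤ r)
    (hP : IsMarkovChain μ (configLaw r) (configMoveProb r) P) {m : ℕ} (hm : 0 < m)
    (hM : 2 * m ≤ ⌊√(n : ℝ) / ε⌋₊ + 1) (t : ℕ) :
    μ.real {ω | ¬∀ c, n / (256 * (m : ℝ) ^ 2) ≤ ({v | gridCell hm (P t ω v) = c}.ncard : ℝ) ∧
        ({v | gridCell hm (P t ω v) = c}.ncard : ℝ) ≤ 256 * n / (m : ℝ) ^ 2} ≤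
      (m : ℝ) ^ 2 * (2 * Real.exp (-(n / (256 * (m : ℝ) ^ 2)))) := by
  classical
  have hm' : (0 : ℝ) < m := by exact_mod_cast hm
  set lo := n / (256 * (m : ℝ) ^ 2) with hlo
  set hi := 256 * n / (m : ℝ) ^ 2 with hhi
  have hlo0 : 0 ≤ lo := by positivity
  have hhilo : hi = 65536 * lo := by rw [hlo, hhi]; field_simp; ring
  set N : Fin m × Fin m → Ω → ℝ := fun c ω => ({v | gridCell hm (P t ω v) = c}.ncard : ℝ) with hN
  have hsub : {ω | ¬∀ c, lo ≤ N c ω ∧ N c ω ≤ hi} ⊆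
      ⋃ c, ({ω | -lo ≤ -1 * N c ω} ∪ {ω | hi ≤ 1 * N c ω}) := by
    intro ω hω
    simp only [Set.mem_ofPred_eq, not_forall, not_and_or, not_le] at hω
    obtain ⟨c, hc⟩ := hω
    refine Set.mem_iUnion.2 ⟨c, ?_⟩
    rcases hc with hc | hc
    · left
      simp only [Set.mem_ofPred_eq]
      linarith
    · right
      simp only [Set.mem_ofPred_eq]
      linarith
  have hcell : ∀ c, μ.real ({ω | -lo ≤ -1 * N c ω} ∪ {ω | hi ≤ 1 * N c ω}) ≤
      2 * Real.exp (-lo) := by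
    intro c
    obtain ⟨hp1, hp2⟩ := sum_nodeLaw_cell_bounds hm hM hr c
    have h1 := measureReal_cell_count_le hr hP hm t c (-1) (-lo)
    have h2 := measureReal_cell_count_le hr hP hm t c 1 hi
    set p := ∑ x : Site n ε with x ∈ {x | gridCell hm x = c}, nodeLaw r x
    have hnp1 : 4 * lo ≤ n * p := by
      calc 4 * lo = n * (1 / (64 * (m : ℝ) ^ 2)) := by rw [hlo]; field_simp; ring
        _ ≤ n * p := by gcongr
    have hnp2 : n * p ≤ 16384 * lo := by
      calc n * p ≤ n * (64 / (m : ℝ) ^ 2) := by gcongr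
        _ = 16384 * lo := by rw [hlo]; field_simp; ring
    -- With `4 lo ≤ np ≤ 16384 lo` and `hi = 65536 lo`, the choices `θ = -1` and `θ = 1` make both
    -- Chernoff exponents at most `-lo`.
    have he1 : Real.exp (-1) ≤ 1 / 2 := by linarith [Real.exp_neg_one_lt_d9]
    have he2 : Real.exp 1 ≤ 3 := by linarith [Real.exp_one_lt_d9]
    have h1' : μ.real {ω | -lo ≤ -1 * N c ω} ≤ Real.exp (-lo) := by
      refine h1.trans (Real.exp_le_exp.2 ?_)
      nlinarith
    have h2' : μ.real {ω | hi ≤ 1 * N c ω} ≤ Real.exp (-lo) := by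
      refine h2.trans (Real.exp_le_exp.2 ?_)
      nlinarith
    exact (measureReal_union_le _ _).trans (by linarith)
  calc μ.real {ω | ¬∀ c, lo ≤ N c ω ∧ N c ω ≤ hi}
      ≤ μ.real (⋃ c, ({ω | -lo ≤ -1 * N c ω} ∪ {ω | hi ≤ 1 * N c ω})) := measureReal_mono hsub
    _ ≤ ∑ c, μ.real ({ω | -lo ≤ -1 * N c ω} ∪ {ω | hi ≤ 1 * N c ω}) :=
        measureReal_iUnion_fintype_le _
    _ ≤ ∑ c : Fin m × Fin m, 2 * Real.exp (-lo) := Finset.sum_le_sum fun c _ => hcell c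
    _ = (m : ℝ) ^ 2 * (2 * Real.exp (-lo)) := by
        rw [Finset.sum_const, Finset.card_univ, Fintype.card_prod, Fintype.card_fin, nsmul_eq_mul,
          Nat.cast_mul, sq]

theorem ae_dist_move_le (hP : IsMarkovChain μ (configLaw r) (configMoveProb r) P) :
    ∀ᵐ ω ∂μ, ∀ t i, dist (P (t + 1) ω i).point (P t ω i).point ≤ r := by
  filter_upwards [hP.ae_transition_ne_zero] with ω hω t i
  have h := Finset.prod_ne_zero_iff.1 (hω t) i (Finset.mem_univ i)
  have hmem : P (t + 1) ω i ∈ reach r (P t ω i) := by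
    by_contra hcon
    exact h (by rw [moveProb, if_neg hcon])
  rw [dist_comm]
  simpa [reach] using hmem

end Probability

/-! ### Speed of information and the lower bound. -/

section Speed

variable {n : ℕ} {r R ε : ℝ} {X : ℕ → Config n ε}

theorem dist_start_le (hX : ∀ t i, dist (X (t + 1) i).point (X t i).point ≤ r) (t : ℕ)
    (v : Fin n) : dist (X t v).point (X 0 v).point ≤ t * r := by
  induction t with
  | zero => simp
  | succ t ih =>
    have := dist_triangle (X (t + 1) v).point (X t v).point (X 0 v).point
    have := hX t v
    push_cast
    linarith

theorem dist_source_le (hX : ∀ t i, dist (X (t + 1) i).point (X t i).point ≤ r) (hR : 0 ≤ R)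
    {G : ℕ → SimpleGraph (Fin n)} (hG : ∀ t, G t = proximityGraph R (X t)) {s v : Fin n} {t : ℕ}
    (hv : v ∈ informed G s t) : dist (X t v).point (X 0 s).point ≤ t * (R + r) := by
  induction t generalizing v with
  | zero =>
    obtain rfl : v = s := hv
    simp
  | succ t ih =>
    have h1 := dist_triangle (X (t + 1) v).point (X t v).point (X 0 s).point
    have h2 := hX t v
    push_cast
    rcases hv with hv | ⟨_, u, hu, huv⟩
    -- The graph at time `t` acts before the move to time `t + 1`: one step costs at most `R` for
    -- the edge plus `r` for the move.
    · have := ih hv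
      linarith
    · have h3 := ih hu
      rw [hG] at huv
      have h4 := dist_triangle_left (X t v).point (X 0 s).point (X t u).point
      have h5 : dist (X t u).point (X t v).point ≤ R := huv.2
      linarith

/-- Flooding between far-apart nodes takes time at least distance over speed. -/
theorem le_floodingTime_of_far (hX : ∀ t i, dist (X (t + 1) i).point (X t i).point ≤ r)
    (hR : 0 ≤ R) {G : ℕ → SimpleGraph (Fin n)} (hG : ∀ t, G t = proximityGraph R (X t))
    {u v : Fin n} {D : ℝ} (hD : D ≤ dist (X 0 u).point (X 0 v).point) {T : ℕ}
    (hT : floodingTime G = T) : D ≤ T * (R + 2 * r) := by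
  have hex : ∃ t ≤ T, informed G u t = Set.univ := by
    by_contra hcon
    push Not at hcon
    have h1 : ((T + 1 : ℕ) : ℕ∞) ≤ completionTime G u := by
      refine le_iInf₂ fun t ht => ?_
      have : T < t := by
        by_contra h
        exact hcon t (not_lt.1 h) ht
      exact_mod_cast this
    have h2 : completionTime G u ≤ T := hT ▸ le_iSup (completionTime G) u
    have h3 : T + 1 ≤ T := by exact_mod_cast h1.trans h2
    omega
  obtain ⟨t, htT, ht⟩ := hex
  have hv : v ∈ informed G u T := informed_mono G u htT (ht ▸ Set.mem_univ v)
  have h1 := dist_source_le hX hR hG hv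
  have h2 := dist_start_le hX T v
  have h3 := dist_triangle_left (X 0 u).point (X 0 v).point (X T v).point
  linarith

end Speed

/-! ### Assembly and choice of constants. -/

/-- Two-sided bound on the flooding time once all cells stay evenly populated. -/
theorem floodingTime_bounds {n m : ℕ} {r R ε : ℝ} (hm : 0 < m) (hm4 : 4 ≤ m) (hn : 0 < n)
    (hε : 0 < ε) (hR : 0 ≤ R) (hcell : 3 * (√n + ε) / m ≤ R) {X : ℕ → Config n ε}
    (hX : ∀ t i, dist (X (t + 1) i).point (X t i).point ≤ r)
    {G : ℕ → SimpleGraph (Fin n)} (hG : ∀ t, G t = proximityGraph R (X t))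
    (heven : ∀ t < 32768 * m + 1, ∀ c,
      n / (256 * (m : ℝ) ^ 2) ≤ ({v | gridCell hm (X t v) = c}.ncard : ℝ) ∧
        ({v | gridCell hm (X t v) = c}.ncard : ℝ) ≤ 256 * n / (m : ℝ) ^ 2) :
    ∃ T : ℕ, floodingTime G = T ∧ T ≤ 32768 * m + 1 ∧ √n / 2 ≤ T * (R + 2 * r) := by
  have hm' : (0 : ℝ) < m := by exact_mod_cast hm
  have hn' : (0 : ℝ) < n := by exact_mod_cast hn
  have hsq : √(n : ℝ) ^ 2 = n := Real.sq_sqrt hn'.le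
  have hupper : floodingTime G ≤ (32768 * m + 1 : ℕ) := by
    refine floodingTime_le_of_cells (m := m) (cell := fun t v => gridCell hm (X t v))
      (lo := n / (256 * (m : ℝ) ^ 2)) (hi := 256 * n / (m : ℝ) ^ 2)
      -- This gain solves `4 * x * √hi = lo` exactly. Then `32768 * m` steps gain exactly `2√n`, and
      -- the extra step makes the inequality strict.
      (x := √n / (16384 * m)) _ (by positivity) (by positivity)
      (fun t ht c => (heven t ht c).1) (fun t ht c => (heven t ht c).2) ?_ (by positivity) ?_ ?_ ?_
    · intro t _ u v huv h
      rw [hG]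
      exact ⟨huv, (dist_point_le_of_cellNear hm hε h).trans hcell⟩
    · have : √(256 * n / (m : ℝ) ^ 2) = 16 * √n / m := by
        rw [show 256 * (n : ℝ) / (m : ℝ) ^ 2 = (16 * √n / m) ^ 2 by
          rw [div_pow, mul_pow, hsq]; norm_num]
        exact Real.sqrt_sq (by positivity)
      rw [this]
      apply le_of_eq
      field_simp
      rw [hsq]
      ring
    · rw [div_pow, hsq, mul_pow, ← mul_div_assoc, div_le_div_iff₀ (by positivity) (by positivity)]
      have : 0 < (n : ℝ) * (m : ℝ) ^ 2 := by positivity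
      nlinarith
    · rw [Fintype.card_fin]
      have h1 : 0 < √(n : ℝ) / (16384 * m) := by positivity
      have h2 : (32768 * (m : ℝ)) * (√(n : ℝ) / (16384 * m)) = 2 * √n := by
        field_simp; ring
      push_cast
      linarith
  have hoccupied : ∀ c, ∃ v, gridCell hm (X 0 v) = c := by
    intro c
    have h1 := (heven 0 (by omega) c).1
    have h2 : (0 : ℝ) < n / (256 * (m : ℝ) ^ 2) := by positivity
    have h3 : 0 < {v | gridCell hm (X 0 v) = c}.ncard := by exact_mod_cast h2.trans_le h1
    exact (Set.ncard_pos (Set.toFinite _)).1 h3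
  obtain ⟨T, hT⟩ := ENat.ne_top_iff_exists.1 (ne_top_of_le_ne_top (ENat.natCast_ne_top _) hupper)
  obtain ⟨u, hu⟩ := hoccupied (⟨0, hm⟩, ⟨0, hm⟩)
  obtain ⟨v, hv⟩ := hoccupied (⟨m - 1, by omega⟩, ⟨0, hm⟩)
  refine ⟨T, hT.symm, ?_, le_floodingTime_of_far hX hR hG
    (le_dist_of_corner_cells hm hm4 hε (congrArg Prod.fst hu) (congrArg Prod.fst hv)) hT.symm⟩
  rw [← hT] at hupper
  exact_mod_cast hupper

theorem mainTheorem6 :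
    ∃ c : ℝ, 0 < c ∧ ∀ K : ℝ, 0 < K → ∃ a b : ℝ, 0 < a ∧ 0 < b ∧ ∃ n₀ : ℕ,
      ∀ n : ℕ, n₀ ≤ n → ∀ r R ε : ℝ, 0 < ε → ε ≤ 1 → ε < R → 0 ≤ r → r ≤ K * R →
        c * √(Real.log n) ≤ R → R ≤ √(n : ℝ) / Real.log (Real.log n) →
        ∀ (Ω : Type*) [MeasurableSpace Ω] (μ : Measure Ω) [IsProbabilityMeasure μ]
          (G : ℕ → Ω → SimpleGraph (Fin n)), IsStationaryGeometricMEG μ n r R ε G →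
          1 - 1 / (n : ℝ) ≤ μ.real {ω | ∃ T : ℕ, floodingTime (fun t => G t ω) = (T : ℕ∞) ∧
            a * (√(n : ℝ) / R) ≤ (T : ℝ) ∧ (T : ℝ) ≤ b * (√(n : ℝ) / R)} := by
  -- `163845 = 5 * 32769` comes from `m ≤ 5√n/R` and `32768 m + 1 ≤ 32769 m`. The constant 200000
  -- exceeds it, so the number of steps is at most `√n`. From 16 on, `log log n ≥ 1`, hence `R ≤
  -- √n`.
  refine ⟨200000, by norm_num, fun K hK => ⟨1 / (2 * (1 + 2 * K)), 163845, by positivity,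
    by norm_num, 16, ?_⟩⟩
  rintro n hn r R ε hε hε1 - hr hrK hcR hRn Ω _ μ _ G ⟨P, hP, hG⟩
  have hn16 : (16 : ℝ) ≤ n := by exact_mod_cast hn
  have hlog : Real.exp 1 ≤ Real.log n := by
    have h1 : Real.log 16 ≤ Real.log n := Real.log_le_log (by norm_num) hn16
    have h2 : Real.log 16 = 4 * Real.log 2 := by
      rw [show (16 : ℝ) = 2 ^ 4 by norm_num, Real.log_pow]; norm_num
    linarith [Real.log_two_gt_d9, Real.exp_one_lt_d9]
  have hlog1 : 1 ≤ Real.log n := (Real.one_le_exp zero_le_one).trans hlog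
  have hloglog : 1 ≤ Real.log (Real.log n) := (Real.le_log_iff_exp_le (by linarith)).2 hlog
  have hs4 : 4 ≤ √(n : ℝ) := Real.le_sqrt_of_sq_le (by linarith)
  have hsq : √(n : ℝ) ^ 2 = n := Real.sq_sqrt (by linarith)
  have hR1 : 200000 ≤ R := by
    have : 1 ≤ √(Real.log n) := Real.one_le_sqrt.2 hlog1
    linarith
  have hR0 : 0 < R := by linarith
  have hRs : R ≤ √(n : ℝ) := hRn.trans (div_le_self (by positivity) hloglog)
  have hL1 : 1 ≤ √(n : ℝ) / R := (one_le_div hR0).2 hRs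
  set m := ⌈4 * √(n : ℝ) / R⌉₊ with hmdef
  have hm_ge : 4 * √(n : ℝ) / R ≤ m := Nat.le_ceil _
  have hm_le : (m : ℝ) ≤ 5 * (√(n : ℝ) / R) := by
    have := Nat.ceil_lt_add_one (by positivity : 0 ≤ 4 * √(n : ℝ) / R)
    rw [← hmdef, mul_div_assoc] at this
    linarith
  have hm4' : (4 : ℝ) ≤ m := by rw [mul_div_assoc] at hm_ge; linarith
  have hm4 : 4 ≤ m := by exact_mod_cast hm4'
  have hm : 0 < m := by omega
  have hm' : (0 : ℝ) < m := by linarith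
  have hLs : √(n : ℝ) / R * 200000 ≤ √(n : ℝ) := by
    rw [div_mul_eq_mul_div, div_le_iff₀ hR0]
    exact mul_le_mul_of_nonneg_left hR1 (by positivity)
  have hT0 : 32768 * (m : ℝ) + 1 ≤ 163845 * (√(n : ℝ) / R) := by linarith
  have hM : 2 * m ≤ ⌊√(n : ℝ) / ε⌋₊ + 1 := by
    have h1 : √(n : ℝ) ≤ √(n : ℝ) / ε := by
      rw [le_div_iff₀ hε]; exact mul_le_of_le_one_right (by positivity) hε1
    have h2 := Nat.lt_floor_add_one (√(n : ℝ) / ε)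
    have h3 : 2 * (m : ℝ) ≤ (⌊√(n : ℝ) / ε⌋₊ : ℝ) + 1 := by linarith
    exact_mod_cast h3
  have hcell : 3 * (√(n : ℝ) + ε) / m ≤ R := by
    rw [div_le_iff₀ hm']
    rw [div_le_iff₀ hR0] at hm_ge
    linarith
  -- This makes each cell's failure probability at most `2 n⁻⁴`; at most `n` times and `n` cells
  -- leave `2/n² ≤ 1/n`.
  have hdens : 4 * Real.log n ≤ n / (256 * (m : ℝ) ^ 2) := by
    have h1 : (200000 * √(Real.log n)) ^ 2 ≤ R ^ 2 := pow_le_pow_left₀ (by positivity) hcR 2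
    rw [mul_pow, Real.sq_sqrt (by linarith)] at h1
    have h2 : (m * R) ^ 2 ≤ (5 * √(n : ℝ)) ^ 2 := by
      refine pow_le_pow_left₀ (by positivity) ?_ 2
      rwa [← mul_div_assoc, le_div_iff₀ hR0] at hm_le
    rw [mul_pow, mul_pow, hsq] at h2
    have h3 := mul_le_mul_of_nonneg_left h1 (sq_nonneg (m : ℝ))
    rw [le_div_iff₀ (by positivity)]
    nlinarith [mul_nonneg (sq_nonneg (m : ℝ)) (by linarith : (0 : ℝ) ≤ Real.log n)]
  set good : Set Ω := {ω | ∃ T : ℕ, floodingTime (fun t => G t ω) = (T : ℕ∞) ∧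
            1 / (2 * (1 + 2 * K)) * (√(n : ℝ) / R) ≤ (T : ℝ) ∧
            (T : ℝ) ≤ 163845 * (√(n : ℝ) / R)} with hgood
  set moves : Set Ω := {ω | ¬∀ t i, dist (P (t + 1) ω i).point (P t ω i).point ≤ r} with hmoves
  set uneven : ℕ → Set Ω := fun t => {ω | ¬∀ c,
    n / (256 * (m : ℝ) ^ 2) ≤ ({v | gridCell hm (P t ω v) = c}.ncard : ℝ) ∧
      ({v | gridCell hm (P t ω v) = c}.ncard : ℝ) ≤ 256 * n / (m : ℝ) ^ 2} with huneven
  have hcover : Set.univ ⊆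
      (good ∪ moves) ∪ ⋃ t ∈ Finset.range (32768 * m + 1), uneven t := by
    intro ω _
    by_cases h1 : ω ∈ moves
    · exact Or.inl (Or.inr h1)
    by_cases h2 : ω ∈ ⋃ t ∈ Finset.range (32768 * m + 1), uneven t
    · exact Or.inr h2
    left; left
    have h1' : ∀ t i, dist (P (t + 1) ω i).point (P t ω i).point ≤ r := not_not.1 h1
    obtain ⟨T, hT, hTu, hTl⟩ := floodingTime_bounds (X := fun t => P t ω)
      (G := fun t => G t ω) hm hm4 (by omega) hε hR0.le hcell h1' (fun t => hG t ω) (by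
        intro t ht
        by_contra hcon
        exact h2 (Set.mem_biUnion (Finset.mem_coe.2 (Finset.mem_range.2 ht)) hcon))
    refine ⟨T, hT, ?_, ?_⟩
    · have h3 : (T : ℝ) * (R + 2 * r) ≤ T * ((1 + 2 * K) * R) := by gcongr; linarith
      rw [div_mul_div_comm, one_mul, div_le_iff₀ (by positivity)]
      linarith
    · refine le_trans ?_ hT0
      exact_mod_cast hTu
  have hmoves0 : μ.real moves = 0 :=
    (measureReal_eq_zero_iff).2 (ae_iff.1 (ae_dist_move_le hP))
  have hexp : Real.exp (-(n / (256 * (m : ℝ) ^ 2))) ≤ ((n : ℝ) ^ 4)⁻¹ := by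
    rw [Real.exp_neg, inv_le_inv₀ (Real.exp_pos _) (by positivity),
      ← Real.exp_log (by positivity : (0 : ℝ) < (n : ℝ) ^ 4), Real.log_pow]
    exact Real.exp_le_exp.2 (by exact_mod_cast hdens)
  have hbad : μ.real (⋃ t ∈ Finset.range (32768 * m + 1), uneven t) ≤ 1 / n := by
    calc _ ≤ ∑ t ∈ Finset.range (32768 * m + 1), μ.real (uneven t) :=
          measureReal_biUnion_finset_le _ _
      _ ≤ ∑ t ∈ Finset.range (32768 * m + 1), (m : ℝ) ^ 2 * (2 * ((n : ℝ) ^ 4)⁻¹) := by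
          refine Finset.sum_le_sum fun t _ =>
            (measureReal_uneven_cells_le hr hP hm hM t).trans ?_
          gcongr
      _ = (32768 * (m : ℝ) + 1) * ((m : ℝ) ^ 2 * (2 * ((n : ℝ) ^ 4)⁻¹)) := by
          rw [Finset.sum_const, Finset.card_range, nsmul_eq_mul]; push_cast; ring
      _ ≤ n * (n * (2 * ((n : ℝ) ^ 4)⁻¹)) := by
          have h1 : 32768 * (m : ℝ) + 1 ≤ n := by nlinarith
          have h2 : (m : ℝ) ^ 2 ≤ n := by
            rw [← hsq]
            exact pow_le_pow_left₀ hm'.le (by linarith) 2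
          gcongr
      _ ≤ 1 / n := by
          rw [show (n : ℝ) * (n * (2 * ((n : ℝ) ^ 4)⁻¹)) = (2 / n) * (1 / n) by field_simp]
          refine mul_le_of_le_one_left (by positivity) ?_
          rw [div_le_one (by positivity)]
          linarith
  have h1 : (1 : ℝ) ≤ μ.real good + μ.real moves +
      μ.real (⋃ t ∈ Finset.range (32768 * m + 1), uneven t) := by
    calc (1 : ℝ) = μ.real Set.univ := by simp
      _ ≤ _ := measureReal_mono hcover
      _ ≤ _ := measureReal_union_le _ _
      _ ≤ _ := add_le_add_left (measureReal_union_le _ _) _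
  linarith
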